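/- Let $k$ be an algebraically closed field of characteristic zero, and let $\mathcal C$ be a braided tensor category over $k$, that is, a $k$-linear abelian braided monoidal category whose tensor product is $k$-bilinear on morphisms and whose unit object $I$ is simple. Let $A$ be an étale algebra in $\mathcal C$: an associative unital algebra with multiplication $m\colon A\otimes A\to A$ which is commutative ($m\circ c_{A,A}=m$ for the braiding $c$), separable ($m$ has a section $A\to A\otimes A$ which is a morphism of $A$-bimodules) and connected ($\dim_k\mathcal C(I,A)=1$). Let $H$ be a Hopf algebra over $k$ acting on $A$, that is, given together with a homomorphism of unital $k$-algebras $a\colon H\to\mathcal C(A,A)$ (with composition as the product of $\mathcal C(A,A)$) such that $a(h)\circ m=\sum_{(h)} m\circ\bigl(a(h_{(0)})\otimes a(h_{(1)})\bigr)$ for all $h\in H$, where $\delta(h)=\sum_{(h)}h_{(0)}\otimes h_{(1)}$ is the coproduct of $H$. Assume that the action is faithful, that is, that $a$ is injective. Then $H$ is the group algebra of a group of automorphisms of $A$: there are a subgroup $G\subset\mathrm{Aut}_{\mathrm{alg}}(A)$ of the group of algebra automorphisms of $A$ and an isomorphism of Hopf algebras $\varphi\colon k[G]\to H$ such that $a(\varphi(g))=g$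 as a morphism $A\to A$ for every $g\in G$. -/

import Mathlib

open CategoryTheory MonoidalCategory
open scoped MonObj

universe w x v u

/-- A separable algebra: the multiplication `A ⊗ A ⟶ A` has a section which is a morphism
of `A`-bimodules. -/
def IsSeparableAlgObj {C : Type u} [Category.{v} C] [MonoidalCategory C] (A : C) [MonObj A] :
    Prop :=
  ∃ σ : A ⟶ A ⊗ A,
    σ ≫ μ[A] = 𝟙 A ∧
    μ[A] ≫ σ = (A ◁ σ) ≫ (α_ A A A).inv ≫ (μ[A] ▷ A) ∧
    μ[A] ≫ σ = (σ ▷ A) ≫ (α_ A A A).hom ≫ (A ◁ μ[A])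

/-- A connected algebra over `k`: the space of morphisms from the unit object to `A` is
one-dimensional. -/
def IsConnectedAlgObj (k : Type w) [Field k] {C : Type u} [Category.{v} C] [Preadditive C]
    [Linear k C] [MonoidalCategory C] (A : C) : Prop :=
  Module.finrank k (𝟙_ C ⟶ A) = 1

/-- An étale algebra in a `k`-linear braided monoidal category: commutative, separable and
connected. -/
structure IsEtaleAlgObj (k : Type w) [Field k] {C : Type u} [Category.{v} C] [Preadditive C]
    [Linear k C] [MonoidalCategory C] [BraidedCategory C] (A : C) [MonObj A] : Prop where
  comm : (β_ A A).hom ≫ μ[A] = μ[A]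
  separable : IsSeparableAlgObj A
  connected : IsConnectedAlgObj k A

/-- The linear map `C(A, A) ⊗ C(A, A) → C(A ⊗ A, A ⊗ A)`, `f ⊗ g ↦ f ⊗ₘ g`. -/
noncomputable def endTensorEnd (k : Type w) [Field k] {C : Type u} [Category.{v} C]
    [Preadditive C] [Linear k C] [MonoidalCategory C] [MonoidalPreadditive C]
    [MonoidalLinear k C] (A : C) :
    TensorProduct k (End A) (End A) →ₗ[k] End (A ⊗ A) :=
  TensorProduct.lift
    (LinearMap.mk₂ k (fun f g : End A => End.of (End.asHom f ⊗ₘ End.asHom g))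
      (fun f₁ f₂ g => MonoidalPreadditive.add_tensor (End.asHom f₁) (End.asHom f₂) (End.asHom g))
      (fun c f g => by
        change (c • End.asHom f) ⊗ₘ End.asHom g = c • (End.asHom f ⊗ₘ End.asHom g)
        simp [MonoidalCategory.tensorHom_def])
      (fun f g₁ g₂ => MonoidalPreadditive.tensor_add (End.asHom f) (End.asHom g₁) (End.asHom g₂))
      (fun c f g => by
        change End.asHom f ⊗ₘ (c • End.asHom g) = c • (End.asHom f ⊗ₘ End.asHom g)
        simp [MonoidalCategory.tensorHom_def]))

/-- An action of a bialgebra `H` on an algebra `A` in a `k`-linear monoidal category, written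
as a homomorphism of `k`-algebras `H → C(A, A)`, where the product of `C(A, A)` is the
composition `f * g = f ∘ g`. The multiplication of `A` satisfies
`h ∘ μ = ∑ μ ∘ (h₍₀₎ ⊗ h₍₁₎)` in Sweedler's notation for the coproduct of `H`. -/
structure BialgebraAction (k : Type w) [Field k] {C : Type u} [Category.{v} C]
    [Preadditive C] [Linear k C] [MonoidalCategory C] [MonoidalPreadditive C]
    [MonoidalLinear k C] (H : Type x) [Ring H] [Bialgebra k H] (A : C) [MonObj A] where
  toEnd : H →ₐ[k] End A
  mul_act : ∀ h : H,
    μ[A] ≫ End.asHom (toEnd h) =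
      End.asHom (endTensorEnd k A
        (TensorProduct.map toEnd.toLinearMap toEnd.toLinearMap (Coalgebra.comul h))) ≫ μ[A]

/-- An action is faithful if the corresponding map `H → C(A, A)` is injective. -/
def BialgebraAction.IsFaithful {k : Type w} [Field k] {C : Type u} [Category.{v} C]
    [Preadditive C] [Linear k C] [MonoidalCategory C] [MonoidalPreadditive C]
    [MonoidalLinear k C] {H : Type x} [Ring H] [Bialgebra k H] {A : C} [MonObj A]
    (a : BialgebraAction k H A) : Prop :=
  Function.Injective a.toEnd

/-- The group of algebra automorphisms of `A`, with product `g * h = g ∘ h`. -/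
abbrev AutAlg {C : Type u} [Category.{v} C] [MonoidalCategory C] (A : C) [MonObj A] : Type v :=
  Aut (Mon.mk A)

/-! Separability of `A` passes to `H` as coseparability. Let `e : 𝟙_ C ⟶ A ⊗ A` be the section of
the multiplication composed with the unit. As `A` is connected, `μ ∘ (h ⊗ x) ∘ e` is a scalar `B(h,
x)` times the unit. Evaluating `μ ∘ (h ⊗ x)` on the section through its left and right bimodule
property, and using faithfulness, makes `B` a coseparability form (`isCoseparableForm`).

The antipode gives `B(uh, x) = B(h, S(u)x)` (`form_mul_left`), which forces `B` to be nondegenerate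
(`IsCoseparableForm.injective`). Commutativity of `A` only says that `Δ h` and its flip have the
same image in `C(A ⊗ A, A)`. Contracting with `B` factors through that image, so nondegeneracy makes
`H` cocommutative.

On a cocommutative coalgebra the operators `R_f : h ↦ ∑ f(h₍₁₎) h₍₀₎` commute, and coseparability
excludes nilpotent behaviour: `R_f² v = 0` implies `R_f v = 0`. Over an algebraically closed field
they are therefore simultaneously diagonalizable on finite-dimensional stable subspaces. A common
eigenvector is a multiple of a group-like element, so group-likes span `H`. They are linearly
independent and act by algebra automorphisms, whence `H = k[G]`. -/

section Coalgebra

/-! ### Hit operators of the dual on a coalgebra. -/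

open TensorProduct Coalgebra Module

variable {k : Type*} [Field k] {H : Type*} [AddCommGroup H] [Module k H] [Coalgebra k H]

/-- The operator `h ↦ ∑ f(h₍₁₎) h₍₀₎` on a coalgebra attached to a linear functional `f`. -/
noncomputable def Coalgebra.rightHit (f : Dual k H) : H →ₗ[k] H :=
  (_root_.TensorProduct.rid k H).toLinearMap ∘ₗ f.lTensor H ∘ₗ comul

/-- The operator `h ↦ ∑ f(h₍₀₎) h₍₁₎` on a coalgebra attached to a linear functional `f`. -/
noncomputable def Coalgebra.leftHit (f : Dual k H) : H →ₗ[k] H :=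
  (_root_.TensorProduct.lid k H).toLinearMap ∘ₗ f.rTensor H ∘ₗ comul

namespace Coalgebra

lemma rightHit_apply (f : Dual k H) (h : H) :
    rightHit f h = _root_.TensorProduct.rid k H (f.lTensor H (comul h)) := rfl

lemma leftHit_apply (f : Dual k H) (h : H) :
    leftHit f h = _root_.TensorProduct.lid k H (f.rTensor H (comul h)) := rfl

omit [Coalgebra k H] in
lemma lTensor_rid_assoc_tmul (f : Dual k H) (z : H ⊗[k] H) (y : H) :
    ((_root_.TensorProduct.rid k H).toLinearMap ∘ₗ f.lTensor H).lTensor H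
      (_root_.TensorProduct.assoc k H H H (z ⊗ₜ y)) = f y • z := by
  induction z with
  | zero => simp
  | add a b ha hb => simp only [TensorProduct.add_tmul, map_add, ha, hb, smul_add]
  | tmul u v => simp [TensorProduct.smul_tmul']

/-- Both sides are `(f ⊗ g)(Δ h)`. -/
lemma dual_apply_leftHit (f g : Dual k H) (h : H) : g (leftHit f h) = f (rightHit g h) := by
  have key : ∀ t : H ⊗[k] H, g (_root_.TensorProduct.lid k H (f.rTensor H t)) =
      f (_root_.TensorProduct.rid k H (g.lTensor H t)) := by
    intro t
    induction t with
    | zero => simp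
    | add a b ha hb => simp only [map_add, ha, hb]
    | tmul x y => simp [mul_comm]
  exact key _

/-- Coassociativity: contracting the last leg commutes with splitting the first one. -/
lemma comul_rightHit (f : Dual k H) (h : H) :
    comul (rightHit f h) = (rightHit f).lTensor H (comul (R := k) h) := by
  have key : ∀ t : H ⊗[k] H, comul (_root_.TensorProduct.rid k H (f.lTensor H t)) =
      ((_root_.TensorProduct.rid k H).toLinearMap ∘ₗ f.lTensor H).lTensor H
        (_root_.TensorProduct.assoc k H H H ((comul (R := k)).rTensor H t)) := by
    intro t
    induction t with
    | zero => simp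
    | add a b ha hb => simp only [map_add, ha, hb]
    | tmul u v =>
      rw [LinearMap.rTensor_tmul, lTensor_rid_assoc_tmul]
      simp
  rw [rightHit_apply, key, coassoc_apply, rightHit, ← LinearMap.comp_assoc,
    LinearMap.lTensor_comp _ _ comul, LinearMap.comp_apply]

lemma rightHit_rightHit (f g : Dual k H) (h : H) :
    rightHit f (rightHit g h) = rightHit (f ∘ₗ rightHit g) h := by
  rw [rightHit_apply f, comul_rightHit, rightHit_apply, LinearMap.lTensor_comp]
  rfl

lemma rightHit_counit : rightHit (counit : Dual k H) = LinearMap.id := by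
  ext h
  simp [rightHit_apply]

lemma rightHit_sub_smul_counit (f : Dual k H) (c : k) :
    rightHit (f - c • counit) = rightHit f - c • LinearMap.id := by
  rw [← rightHit_counit]
  ext h
  simp only [rightHit_apply, LinearMap.lTensor_sub, LinearMap.lTensor_smul, LinearMap.sub_apply,
    LinearMap.smul_apply, map_sub, map_smul]

/-! ### Cocommutative coalgebras and the product attached to a form. -/

section Cocommutative

variable (hc : ∀ h : H, _root_.TensorProduct.comm k H H (comul h) = comul h)

include hc in
lemma leftHit_eq_rightHit (f : Dual k H) : leftHit f = rightHit f := by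
  have key : ∀ t : H ⊗[k] H, _root_.TensorProduct.lid k H (f.rTensor H (_root_.TensorProduct.comm k H H t)) =
      _root_.TensorProduct.rid k H (f.lTensor H t) := by
    intro t
    induction t with
    | zero => simp
    | add a b ha hb => simp only [map_add, ha, hb]
    | tmul u v => simp
  ext h
  rw [leftHit_apply, rightHit_apply, ← key, hc]

include hc in
lemma comul_rightHit_of_cocommutative (f : Dual k H) (h : H) :
    comul (rightHit f h) = (rightHit f).rTensor H (comul (R := k) h) := by
  rw [← hc, comul_rightHit, ← LinearMap.comm_comp_lTensor_comp_comm_eq]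
  simp [hc]

include hc in
lemma rightHit_comm (f g : Dual k H) (h : H) :
    rightHit f (rightHit g h) = rightHit g (rightHit f h) := by
  have key : ∀ t : H ⊗[k] H, _root_.TensorProduct.rid k H
      (f.lTensor H ((rightHit g).rTensor H t)) =
        rightHit g (_root_.TensorProduct.rid k H (f.lTensor H t)) := by
    intro t
    induction t with
    | zero => simp
    | add a b ha hb => simp only [map_add, ha, hb]
    | tmul u v => simp
  rw [rightHit_apply f, comul_rightHit_of_cocommutative hc, key, ← rightHit_apply]

section Form

variable (B : H →ₗ[k] H →ₗ[k] k)

/-- The product `x ⊗ y ↦ ∑ B(x₍₁₎, y) x₍₀₎` attached to a bilinear form on a coalgebra. -/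
noncomputable def formMul : H ⊗[k] H →ₗ[k] H :=
  (_root_.TensorProduct.rid k H).toLinearMap ∘ₗ (TensorProduct.lift B).lTensor H ∘ₗ
    (_root_.TensorProduct.assoc k H H H).toLinearMap ∘ₗ (comul (R := k)).rTensor H

lemma formMul_tmul (x y : H) : formMul B (x ⊗ₜ y) = rightHit (B.flip y) x := by
  have key : ∀ t : H ⊗[k] H, _root_.TensorProduct.rid k H ((TensorProduct.lift B).lTensor H
      (_root_.TensorProduct.assoc k H H H (t ⊗ₜ y))) =
        _root_.TensorProduct.rid k H ((B.flip y).lTensor H t) := by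
    intro t
    induction t with
    | zero => simp
    | add a b ha hb => simp only [TensorProduct.add_tmul, map_add, ha, hb]
    | tmul u v => simp
  exact key _

variable {B}

/-- By coassociativity the left side is `∑ B(h₍₁₎, h₍₂₎) h₍₀₎ = ∑ ε(h₍₁₎) h₍₀₎`. Thus `formMul B`
splits the coproduct. -/
lemma formMul_comul (hB : ∀ h : H, TensorProduct.lift B (comul h) = counit (R := k) h) (h : H) :
    formMul B (comul h) = h := by
  have hB' : TensorProduct.lift B ∘ₗ comul = counit (R := k) (A := H) := LinearMap.ext hB
  simp only [formMul, LinearMap.comp_apply, LinearEquiv.coe_coe]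
  rw [coassoc_apply, ← LinearMap.comp_apply, ← LinearMap.lTensor_comp, hB']
  simp

include hc in
lemma formMul_rTensor_rightHit (f : Dual k H) (t : H ⊗[k] H) :
    formMul B ((rightHit f).rTensor H t) = rightHit f (formMul B t) := by
  induction t with
  | zero => simp
  | add a b ha hb => simp only [map_add, ha, hb]
  | tmul x y => rw [LinearMap.rTensor_tmul, formMul_tmul, formMul_tmul, rightHit_comm hc]

-- The invariance of `B` rewrites the product as a hit operator applied to the second factor, and
-- hit operators commute.
include hc in
lemma formMul_lTensor_rightHit (hB : ∀ h x : H, rightHit (B.flip x) h = leftHit (B h) x)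
    (f : Dual k H) (t : H ⊗[k] H) :
    formMul B ((rightHit f).lTensor H t) = rightHit f (formMul B t) := by
  induction t with
  | zero => simp
  | add a b ha hb => simp only [map_add, ha, hb]
  | tmul x y =>
    rw [LinearMap.lTensor_tmul, formMul_tmul, formMul_tmul, hB, hB, leftHit_eq_rightHit hc,
      rightHit_comm hc]

end Form

end Cocommutative

omit [Coalgebra k H] in
/-- Every linear map over a field has a pseudo-inverse. -/
lemma exists_comp_comp_eq_self (F : H →ₗ[k] H) : ∃ q : H →ₗ[k] H, F ∘ₗ q ∘ₗ F = F := by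
  obtain ⟨q₀, hq₀⟩ := F.rangeRestrict.exists_rightInverse_of_surjective F.range_rangeRestrict
  obtain ⟨q, hq⟩ := LinearMap.exists_extend q₀
  refine ⟨q, LinearMap.ext fun x => ?_⟩
  have h1 : q (F x) = q₀ (F.rangeRestrict x) := LinearMap.congr_fun hq (F.rangeRestrict x)
  have h2 := congrArg Subtype.val (LinearMap.congr_fun hq₀ (F.rangeRestrict x))
  simpa [h1] using h2

/-- A coseparability form on a coalgebra: a bilinear form `B` with
`∑ B(h₍₁₎, x) h₍₀₎ = ∑ B(h, x₍₀₎) x₍₁₎` and `∑ B(h₍₀₎, h₍₁₎) = ε(h)`. -/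
structure IsCoseparableForm (B : H →ₗ[k] H →ₗ[k] k) : Prop where
  rightHit_eq_leftHit : ∀ h x : H, rightHit (B.flip x) h = leftHit (B h) x
  lift_comul : ∀ h : H, TensorProduct.lift B (comul h) = counit (R := k) h

/-! ### Coseparability makes the hit operators semisimple. -/

section Coseparable

variable (hc : ∀ h : H, _root_.TensorProduct.comm k H H (comul h) = comul h)
  {B : H →ₗ[k] H →ₗ[k] k} (hB : IsCoseparableForm B)

-- Write `R = R_f`, `R = R q R` and `m = formMul B`. Since `m Δ = 1` and `m` does not distinguish `R
-- ⊗ 1` from `1 ⊗ R`, the factor `R` to the left of `q` can be moved to the other leg, past `q`, and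
-- absorbed by `Δ`: `R v = m (1 ⊗ q) Δ (R² v)`.
include hc hB in
lemma rightHit_eq_zero_of_rightHit_rightHit_eq_zero (f : Dual k H) (v : H)
    (hv : rightHit f (rightHit f v) = 0) : rightHit f v = 0 := by
  obtain ⟨q, hq⟩ := exists_comp_comp_eq_self (rightHit f)
  calc rightHit f v
      = formMul B ((rightHit f).lTensor H (comul v)) := by
        rw [← comul_rightHit, formMul_comul hB.lift_comul]
    _ = formMul B ((rightHit f).lTensor H (q.lTensor H (comul (rightHit f v)))) := by
        rw [comul_rightHit]
        conv_lhs => rw [← hq]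
        simp only [LinearMap.lTensor_comp, LinearMap.comp_apply]
    _ = formMul B ((rightHit f).rTensor H (q.lTensor H (comul (rightHit f v)))) := by
        rw [formMul_lTensor_rightHit hc hB.rightHit_eq_leftHit, formMul_rTensor_rightHit hc]
    _ = formMul B (q.lTensor H (comul (rightHit f (rightHit f v)))) := by
        rw [comul_rightHit_of_cocommutative hc f (rightHit f v)]
        rw [← LinearMap.comp_apply ((rightHit f).rTensor H), LinearMap.rTensor_comp_lTensor,
          ← LinearMap.lTensor_comp_rTensor, LinearMap.comp_apply]
    _ = 0 := by simp [hv]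

-- Since `R_f - c = R_{f - cε}` is again a hit operator, the absence of nilpotents lowers the
-- exponent down to 1.
include hc hB in
lemma rightHit_eq_smul_of_pow_apply_eq_zero (f : Dual k H) (c : k) (n : ℕ) (v : H)
    (hv : ((rightHit f - c • LinearMap.id : Module.End k H) ^ n) v = 0) :
    rightHit f v = c • v := by
  rw [← rightHit_sub_smul_counit] at hv
  have key : rightHit (f - c • counit) v = 0 := by
    induction n with
    | zero => simp_all
    | succ n ih =>
      rcases n with _ | n
      · simpa using hv
      · refine ih ?_
        rw [pow_succ', Module.End.mul_apply]
        rw [pow_succ', pow_succ', Module.End.mul_apply, Module.End.mul_apply] at hv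
        exact rightHit_eq_zero_of_rightHit_rightHit_eq_zero hc hB _ _ hv
  rw [rightHit_sub_smul_counit] at key
  simpa [sub_eq_zero] using key

end Coseparable

omit [Coalgebra k H] in
/-- An element of `V ⊗ H` is determined by its contractions with the functionals on `H`. -/
lemma tensor_ext_lTensor_dual {V : Type*} [AddCommGroup V] [Module k V] {s t : V ⊗[k] H}
    (hst : ∀ f : Dual k H, f.lTensor V s = f.lTensor V t) : s = t := by
  classical
  let b := Basis.ofVectorSpace k H
  have key : ∀ (i) (t : V ⊗[k] H), TensorProduct.equivFinsuppOfBasisRight b t i =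
      _root_.TensorProduct.rid k V ((b.coord i).lTensor V t) := by
    intro i t
    induction t with
    | zero => simp
    | add a b ha hb => simp only [map_add, Finsupp.add_apply, ha, hb]
    | tmul u v => simp
  refine (TensorProduct.equivFinsuppOfBasisRight b).injective (Finsupp.ext fun i => ?_)
  rw [key, key, hst]

/-- A common eigenvector satisfies `Δ v = v ⊗ g`. Coassociativity gives `v ⊗ Δ g = v ⊗ g ⊗ g`, so
`g` is group-like, and the counit gives `v = ε(v) g`. -/
lemma mem_span_isGroupLikeElem_of_rightHit (χ : Dual k H → k) (v : H)
    (hv : ∀ f, rightHit f v = χ f • v) : v ∈ Submodule.span k {g : H | IsGroupLikeElem k g} := by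
  by_cases hv0 : v = 0
  · simp [hv0]
  obtain ⟨φ, hφ⟩ := Module.Projective.exists_dual_eq_one k hv0
  have hχ : ∀ f : Dual k H, f (leftHit φ v) = χ f := by
    intro f
    rw [dual_apply_leftHit, hv, map_smul, hφ, smul_eq_mul, mul_one]
  have hΔ : comul v = v ⊗ₜ[k] leftHit φ v := by
    refine tensor_ext_lTensor_dual fun f => (_root_.TensorProduct.rid k H).injective ?_
    rw [← rightHit_apply, hv, LinearMap.lTensor_tmul, hχ, _root_.TensorProduct.rid_tmul]
  have hε : counit (R := k) (leftHit φ v) = 1 := by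
    rw [hχ]
    have := congrArg φ (hv counit)
    simpa [rightHit_counit, hφ] using this.symm
  have hg : IsGroupLikeElem k (leftHit φ v) := by
    refine ⟨hε, ?_⟩
    have h1 := coassoc_apply (R := k) v
    rw [hΔ, LinearMap.rTensor_tmul, LinearMap.lTensor_tmul, hΔ, _root_.TensorProduct.assoc_tmul] at h1
    have h2 := congrArg (fun t => _root_.TensorProduct.lid k _ (φ.rTensor _ t)) h1
    simpa [hφ] using h2.symm
  have hv' : v = counit (R := k) v • leftHit φ v := by
    have h1 := rTensor_counit_comul (R := k) v
    rw [hΔ] at h1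
    have h2 := congrArg (_root_.TensorProduct.lid k H) h1
    simpa using h2.symm
  rw [hv']
  exact Submodule.smul_mem _ _ (Submodule.subset_span hg)

/-- Every element of a coalgebra lies in a finite-dimensional subspace stable under all the
operators `rightHit f`. -/
lemma exists_finiteDimensional_rightHit_stable (h : H) : ∃ W : Submodule k H, FiniteDimensional k W ∧
    h ∈ W ∧ ∀ f : Dual k H, ∀ w ∈ W, rightHit f w ∈ W := by
  let T : Dual k H →ₗ[k] H :=
    { toFun := fun f => rightHit f h
      map_add' := fun f g => by simp [rightHit_apply, LinearMap.lTensor_add]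
      map_smul' := fun c f => by simp [rightHit_apply, LinearMap.lTensor_smul] }
  refine ⟨LinearMap.range T, ?_, ⟨counit, LinearMap.congr_fun rightHit_counit h⟩, ?_⟩
  · let 𝓡 := ℛ k h
    -- Every `R_f h` is a combination of the finitely many left legs of one expression of `Δ h`.
    have hle : LinearMap.range T ≤ Submodule.span k (𝓡.left '' 𝓡.index) := by
      rintro _ ⟨f, rfl⟩
      change rightHit f h ∈ _
      rw [rightHit_apply, ← 𝓡.eq]
      simp only [map_sum, LinearMap.lTensor_tmul, _root_.TensorProduct.rid_tmul]
      exact Submodule.sum_mem _ fun i hi =>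
        Submodule.smul_mem _ _ (Submodule.subset_span ⟨i, hi, rfl⟩)
    have := FiniteDimensional.span_of_finite k (𝓡.index.finite_toSet.image 𝓡.left)
    exact Submodule.finiteDimensional_of_le hle
  · rintro f _ ⟨g, rfl⟩
    exact ⟨f ∘ₗ rightHit g, (rightHit_rightHit f g h).symm⟩

/-- A cocommutative coseparable coalgebra over an algebraically closed field is spanned by its
group-like elements. -/
theorem span_isGroupLikeElem_eq_top [IsAlgClosed k]
    (hc : ∀ h : H, _root_.TensorProduct.comm k H H (comul h) = comul h)
    {B : H →ₗ[k] H →ₗ[k] k} (hB : IsCoseparableForm B) :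
    Submodule.span k {g : H | IsGroupLikeElem k g} = ⊤ := by
  refine eq_top_iff.2 fun h _ => ?_
  obtain ⟨W, hW, hh, hmaps⟩ := exists_finiteDimensional_rightHit_stable (k := k) h
  let F : Dual k H → Module.End k W := fun f => (rightHit f).restrict (hmaps f)
  have hF : ∀ f w, ((F f w : W) : H) = rightHit f w := fun f w => rfl
  -- Commuting operators decompose `W` into joint generalized eigenspaces, whose vectors are then
  -- shown to be genuine eigenvectors.
  have htop := Module.End.iSup_iInf_maxGenEigenspace_eq_top_of_iSup_maxGenEigenspace_eq_top_of_commute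
    F (fun f g _ => LinearMap.ext fun w => Subtype.ext (rightHit_comm hc f g w))
    (fun f => Module.End.iSup_maxGenEigenspace_eq_top (F f))
  have hle : (⨆ χ : Dual k H → k, ⨅ f, (F f).maxGenEigenspace (χ f)) ≤
      (Submodule.span k {g : H | IsGroupLikeElem k g}).comap W.subtype := by
    refine iSup_le fun χ w hw => mem_span_isGroupLikeElem_of_rightHit χ _ fun f => ?_
    obtain ⟨n, hn⟩ := (Module.End.mem_maxGenEigenspace _ _ _).1 ((Submodule.mem_iInf _).1 hw f)
    refine rightHit_eq_smul_of_pow_apply_eq_zero hc hB f (χ f) n _ ?_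
    have key : ∀ (m : ℕ) (u : W), ((((F f - χ f • 1) ^ m) u : W) : H) =
        ((rightHit f - χ f • LinearMap.id : Module.End k H) ^ m) u := by
      intro m
      induction m with
      | zero => simp
      | succ m ih =>
        intro u
        rw [pow_succ, pow_succ, Module.End.mul_apply, Module.End.mul_apply, ih]
        rfl
    rw [Submodule.subtype_apply, ← key, hn, Submodule.coe_zero]
  rw [htop] at hle
  exact hle (Submodule.mem_top (x := ⟨h, hh⟩))

end Coalgebra

end Coalgebra

/-! ### Nondegeneracy of the form on a Hopf algebra. -/

section HopfForm

open TensorProduct Coalgebra Module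

variable {k : Type*} [Field k] {H : Type*}

lemma lTensor_eq_zero_of_flip [AddCommGroup H] [Module k H] {V : Type*} [AddCommGroup V] [Module k V]
    (B : H →ₗ[k] H →ₗ[k] k) (t : V ⊗[k] H) (ht : ∀ x, (B.flip x).lTensor V t = 0) :
    B.lTensor V t = 0 := by
  classical
  let b := Basis.ofVectorSpace k V
  have key : ∀ (i) (x : H) (t : V ⊗[k] H),
      TensorProduct.equivFinsuppOfBasisLeft b (B.lTensor V t) i x =
        b.coord i (_root_.TensorProduct.rid k V ((B.flip x).lTensor V t)) := by
    intro i x t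
    induction t with
    | zero => simp
    | add a b ha hb => simp only [map_add, Finsupp.add_apply, LinearMap.add_apply, ha, hb]
    | tmul u v => simp [mul_comm]
  refine (TensorProduct.equivFinsuppOfBasisLeft b).injective (Finsupp.ext fun i => ?_)
  ext x
  rw [key, ht]
  simp

lemma eq_zero_of_lTensor_flip [AddCommGroup H] [Module k H] {V : Type*} [AddCommGroup V] [Module k V]
    {B : H →ₗ[k] H →ₗ[k] k} (hB : Function.Injective B) (t : V ⊗[k] H)
    (ht : ∀ x, (B.flip x).lTensor V t = 0) : t = 0 :=
  Module.Flat.lTensor_preserves_injective_linearMap B hB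
    ((lTensor_eq_zero_of_flip B t ht).trans (map_zero _).symm)

/-- A coseparability form on a Hopf algebra with `B(uh, x) = B(h, S(u)x)` is nondegenerate. -/
theorem Coalgebra.IsCoseparableForm.injective [Ring H] [HopfAlgebra k H] {B : H →ₗ[k] H →ₗ[k] k}
    (hB : IsCoseparableForm B)
    (hS : ∀ u h x, B (u * h) x = B h (HopfAlgebra.antipode k u * x)) : Function.Injective B := by
  have hB1 : B 1 1 = 1 := by simpa [Algebra.TensorProduct.one_def] using hB.lift_comul 1
  -- If `B(h, -) = 0`, invariance gives `∑ h₍₀₎ ⊗ B(h₍₁₎, -) = 0`. Then `ε(h) B(1, x) = ∑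
  -- B(S(h₍₀₎)h₍₁₎, x) = ∑ B(h₍₁₎, S²(h₍₀₎)x) = 0`; take `x = 1`.
  have hcounit : ∀ h, B h = 0 → counit (R := k) h = 0 := by
    intro h hh
    have h0 : B.lTensor H (comul h) = 0 := by
      refine lTensor_eq_zero_of_flip B _ fun x => (_root_.TensorProduct.rid k H).injective ?_
      rw [← rightHit_apply, hB.rightHit_eq_leftHit, hh, leftHit_apply, LinearMap.rTensor_zero]
      simp
    let G : H ⊗[k] Dual k H →ₗ[k] Dual k H := TensorProduct.lift
      ((LinearMap.llcomp k H H k).flip ∘ₗ LinearMap.mul k H ∘ₗ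
        HopfAlgebra.antipode k ∘ₗ HopfAlgebra.antipode k)
    have hG : ∀ t : H ⊗[k] H, B (LinearMap.mul' k H ((HopfAlgebra.antipode k).rTensor H t)) =
        G (B.lTensor H t) := by
      intro t
      induction t with
      | zero => simp
      | add a b ha hb => simp only [map_add, ha, hb]
      | tmul u v => ext x; simp [G, hS]
    have h1 := hG (comul h)
    rw [h0, HopfAlgebra.mul_antipode_rTensor_comul_apply, map_zero, Algebra.algebraMap_eq_smul_one,
      map_smul] at h1
    simpa [hB1] using LinearMap.congr_fun h1 1
  rw [← LinearMap.ker_eq_bot, eq_bot_iff]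
  intro h hh
  rw [LinearMap.mem_ker] at hh
  refine (forall_dual_apply_eq_zero_iff k h).1 fun f => ?_
  -- The kernel of `B` is stable under `leftHit f`, and `ε(leftHit f h) = f h`, so every functional
  -- vanishes at `h`.
  have h1 : B (leftHit f h) = 0 := by
    ext x
    have h2 := dual_apply_leftHit f (B.flip x) h
    rw [hB.rightHit_eq_leftHit, hh] at h2
    simpa [leftHit_apply] using h2
  have h3 := hcounit _ h1
  rwa [dual_apply_leftHit, rightHit_counit] at h3

end HopfForm

/-! ### The form coming from an action on a connected separable algebra. -/

namespace BialgebraAction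

open TensorProduct Coalgebra

variable {k : Type w} [Field k] {C : Type u} [Category.{v} C] [Preadditive C] [Linear k C]
  [MonoidalCategory C] [MonoidalPreadditive C] [MonoidalLinear k C]
  {H : Type x} [Ring H] {A : C} [MonObj A]

section Bialgebra

variable [Bialgebra k H] (a : BialgebraAction k H A)

/-- The action as a linear map to morphisms of `C`. -/
def act : H →ₗ[k] (A ⟶ A) where
  toFun h := End.asHom (a.toEnd h)
  map_add' := map_add a.toEnd
  map_smul' := map_smul a.toEnd

lemma act_one : a.act 1 = 𝟙 A := map_one a.toEnd

lemma act_mul (g h : H) : a.act (g * h) = a.act h ≫ a.act g := map_mul a.toEnd g h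

/-- The linear map `f ⊗ g ↦ μ ∘ (f ⊗ g)` from `H ⊗ H` to `C(A ⊗ A, A)`. -/
noncomputable def actMul : H ⊗[k] H →ₗ[k] (A ⊗ A ⟶ A) :=
  Linear.rightComp k (A ⊗ A) μ[A] ∘ₗ
    (endTensorEnd k A ∘ₗ TensorProduct.map a.toEnd.toLinearMap a.toEnd.toLinearMap :
      H ⊗[k] H →ₗ[k] End (A ⊗ A))

lemma actMul_tmul (f g : H) : a.actMul (f ⊗ₜ g) = (a.act f ⊗ₘ a.act g) ≫ μ[A] := rfl

lemma mul_comp_act (h : H) : μ[A] ≫ a.act h = a.actMul (comul h) := a.mul_act h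

omit [Preadditive C] [MonoidalPreadditive C] in
lemma rightUnitor_inv_whiskerLeft_tensorHom_mul {X Y Z : C} (e : 𝟙_ C ⟶ Y ⊗ Z) (f : X ⟶ A)
    (g : Y ⟶ A) (h : Z ⟶ A) :
    (ρ_ X).inv ≫ (X ◁ e) ≫ (α_ X Y Z).inv ≫ (((f ⊗ₘ g) ≫ μ[A]) ⊗ₘ h) ≫ μ[A] =
      (ρ_ X).inv ≫ (f ⊗ₘ (e ≫ (g ⊗ₘ h) ≫ μ[A])) ≫ μ[A] := by
  have h1 : ((f ⊗ₘ g) ≫ μ[A]) ⊗ₘ h = ((f ⊗ₘ g) ⊗ₘ h) ≫ μ[A] ▷ A := by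
    rw [← tensorHom_id, tensorHom_comp_tensorHom, Category.comp_id]
  have h2 : f ⊗ₘ (e ≫ (g ⊗ₘ h) ≫ μ[A]) = X ◁ e ≫ (f ⊗ₘ (g ⊗ₘ h)) ≫ A ◁ μ[A] := by
    rw [← id_tensorHom, ← id_tensorHom, tensorHom_comp_tensorHom, tensorHom_comp_tensorHom,
      Category.comp_id, Category.id_comp]
  rw [h1, h2, Category.assoc, ← associator_inv_naturality_assoc, MonObj.mul_assoc]
  simp only [Category.assoc, Iso.inv_hom_id_assoc]

omit [Preadditive C] [MonoidalPreadditive C] in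
lemma leftUnitor_inv_whiskerRight_tensorHom_mul {X Y Z : C} (e : 𝟙_ C ⟶ X ⊗ Y) (f : X ⟶ A)
    (g : Y ⟶ A) (h : Z ⟶ A) :
    (λ_ Z).inv ≫ (e ▷ Z) ≫ (α_ X Y Z).hom ≫ (f ⊗ₘ ((g ⊗ₘ h) ≫ μ[A])) ≫ μ[A] =
      (λ_ Z).inv ≫ ((e ≫ (f ⊗ₘ g) ≫ μ[A]) ⊗ₘ h) ≫ μ[A] := by
  have h1 : f ⊗ₘ ((g ⊗ₘ h) ≫ μ[A]) = (f ⊗ₘ (g ⊗ₘ h)) ≫ A ◁ μ[A] := by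
    rw [← id_tensorHom, tensorHom_comp_tensorHom, Category.comp_id]
  have h2 : (e ≫ (f ⊗ₘ g) ≫ μ[A]) ⊗ₘ h = e ▷ Z ≫ ((f ⊗ₘ g) ⊗ₘ h) ≫ μ[A] ▷ A := by
    rw [← tensorHom_id, ← tensorHom_id, tensorHom_comp_tensorHom, tensorHom_comp_tensorHom,
      Category.comp_id, Category.id_comp]
  rw [h1, h2]
  simp only [Category.assoc]
  rw [MonObj.mul_assoc, associator_naturality_assoc]

lemma rightUnitor_inv_tensorHom_smul_one_mul {X : C} (f : X ⟶ A) (r : k) :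
    (ρ_ X).inv ≫ (f ⊗ₘ (r • η[A])) ≫ μ[A] = r • f := by
  rw [MonoidalCategory.tensorHom_def, MonoidalLinear.whiskerLeft_smul]
  simp

lemma leftUnitor_inv_smul_one_tensorHom_mul {X : C} (f : X ⟶ A) (r : k) :
    (λ_ X).inv ≫ ((r • η[A]) ⊗ₘ f) ≫ μ[A] = r • f := by
  rw [MonoidalCategory.tensorHom_def', MonoidalLinear.smul_whiskerRight]
  simp

variable {c : (𝟙_ C ⟶ A) →ₗ[k] k} (hc : ∀ f, f = c f • η[A]) (hc1 : c η[A] = 1)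

variable (c) in
/-- The bilinear form `B` on `H` with `μ ∘ (h ⊗ x) ∘ e = B(h, x) η` for `e : 𝟙 ⟶ A ⊗ A`. -/
noncomputable def form (e : 𝟙_ C ⟶ A ⊗ A) : H →ₗ[k] H →ₗ[k] k :=
  TensorProduct.curry (c ∘ₗ Linear.leftComp k A e ∘ₗ a.actMul)

include hc in
lemma comp_act_mul (e : 𝟙_ C ⟶ A ⊗ A) (h x : H) :
    e ≫ (a.act h ⊗ₘ a.act x) ≫ μ[A] = form a c e h x • η[A] := hc _

include hc in
lemma whiskerLeft_one_comp_actMul (t : H ⊗[k] H) :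
    (ρ_ A).inv ≫ (A ◁ η[A]) ≫ a.actMul t =
      a.act (_root_.TensorProduct.rid k H ((c ∘ₗ Linear.leftComp k A η[A] ∘ₗ a.act).lTensor H t)) := by
  induction t with
  | zero => simp
  | add s t hs ht => simp only [map_add, Preadditive.comp_add, hs, ht]
  | tmul f g =>
    have h1 : η[A] ≫ a.act g = c (η[A] ≫ a.act g) • η[A] := hc _
    rw [actMul_tmul, ← id_tensorHom, tensorHom_comp_tensorHom_assoc, Category.id_comp, h1,
      rightUnitor_inv_tensorHom_smul_one_mul]
    simp

-- Let `χ(h)` be the scalar by which `h` acts on the unit. Applying `h` to `a · 1` gives `h = ∑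
-- χ(h₍₁₎) h₍₀₎` by faithfulness; applying the counit gives `ε = χ`.
include hc in
lemma one_comp_act (ha : a.IsFaithful) (h : H) : η[A] ≫ a.act h = counit (R := k) h • η[A] := by
  let χ : H →ₗ[k] k := c ∘ₗ Linear.leftComp k A η[A] ∘ₗ a.act
  have h1 : h = rightHit χ h := by
    apply ha
    change a.act h = a.act _
    rw [rightHit_apply, ← whiskerLeft_one_comp_actMul a hc, ← mul_comp_act]
    simp
  have h2 : leftHit (counit : H →ₗ[k] k) h = h := by simp [leftHit_apply]
  have h3 : counit (R := k) h = χ h := by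
    conv_lhs => rw [h1]
    rw [← dual_apply_leftHit, h2]
  rw [h3]
  exact hc _

include hc in
lemma whiskerLeft_comp_actMul (e : 𝟙_ C ⟶ A ⊗ A) (x : H) (t : H ⊗[k] H) :
    (ρ_ A).inv ≫ (A ◁ e) ≫ (α_ A A A).inv ≫ (a.actMul t ⊗ₘ a.act x) ≫ μ[A] =
      a.act (_root_.TensorProduct.rid k H (((form a c e).flip x).lTensor H t)) := by
  induction t with
  | zero => simp
  | add s t hs ht =>
    simp only [map_add, Preadditive.comp_add, Preadditive.add_comp, MonoidalPreadditive.add_tensor,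
      hs, ht]
  | tmul f g =>
    rw [actMul_tmul, rightUnitor_inv_whiskerLeft_tensorHom_mul, comp_act_mul a hc,
      rightUnitor_inv_tensorHom_smul_one_mul]
    simp

include hc in
lemma whiskerRight_comp_actMul (e : 𝟙_ C ⟶ A ⊗ A) (h : H) (t : H ⊗[k] H) :
    (λ_ A).inv ≫ (e ▷ A) ≫ (α_ A A A).hom ≫ (a.act h ⊗ₘ a.actMul t) ≫ μ[A] =
      a.act (_root_.TensorProduct.lid k H ((form a c e h).rTensor H t)) := by
  induction t with
  | zero => simp
  | add s t hs ht =>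
    simp only [map_add, Preadditive.comp_add, Preadditive.add_comp, MonoidalPreadditive.tensor_add,
      hs, ht]
  | tmul f g =>
    rw [actMul_tmul, leftUnitor_inv_whiskerRight_tensorHom_mul, comp_act_mul a hc,
      leftUnitor_inv_smul_one_tensorHom_mul]
    simp

omit [Preadditive C] [MonoidalPreadditive C] in
lemma section_eq_whiskerLeft {σ : A ⟶ A ⊗ A}
    (hσ : μ[A] ≫ σ = (A ◁ σ) ≫ (α_ A A A).inv ≫ (μ[A] ▷ A)) :
    σ = (ρ_ A).inv ≫ (A ◁ (η[A] ≫ σ)) ≫ (α_ A A A).inv ≫ (μ[A] ▷ A) := by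
  rw [MonoidalCategory.whiskerLeft_comp, Category.assoc, ← hσ]
  simp

omit [Preadditive C] [MonoidalPreadditive C] in
lemma section_eq_whiskerRight {σ : A ⟶ A ⊗ A}
    (hσ : μ[A] ≫ σ = (σ ▷ A) ≫ (α_ A A A).hom ≫ (A ◁ μ[A])) :
    σ = (λ_ A).inv ≫ ((η[A] ≫ σ) ▷ A) ≫ (α_ A A A).hom ≫ (A ◁ μ[A]) := by
  rw [MonoidalCategory.comp_whiskerRight, Category.assoc, ← hσ]
  simp

-- Both sides of the invariance act as `μ ∘ (h ⊗ x) ∘ σ`, with `σ` recovered from `σ ∘ η` by left or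
-- by right multiplication. The normalization is `h ∘ μ ∘ σ ∘ η = h ∘ η = ε(h) η`.
include hc hc1 in
lemma isCoseparableForm (ha : a.IsFaithful) {σ : A ⟶ A ⊗ A} (hσ : σ ≫ μ[A] = 𝟙 A)
    (hl : μ[A] ≫ σ = (A ◁ σ) ≫ (α_ A A A).inv ≫ (μ[A] ▷ A))
    (hr : μ[A] ≫ σ = (σ ▷ A) ≫ (α_ A A A).hom ≫ (A ◁ μ[A])) :
    IsCoseparableForm (form a c (η[A] ≫ σ)) where
  rightHit_eq_leftHit h x := by
    apply ha
    change a.act _ = a.act _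
    rw [rightHit_apply, leftHit_apply, ← whiskerLeft_comp_actMul a hc,
      ← whiskerRight_comp_actMul a hc, ← mul_comp_act, ← mul_comp_act]
    trans σ ≫ (a.act h ⊗ₘ a.act x) ≫ μ[A]
    · conv_rhs => rw [section_eq_whiskerLeft hl]
      simp only [Category.assoc]
      rw [← tensorHom_id, tensorHom_comp_tensorHom_assoc, Category.id_comp]
    · conv_lhs => rw [section_eq_whiskerRight hr]
      simp only [Category.assoc]
      rw [← id_tensorHom, tensorHom_comp_tensorHom_assoc, Category.id_comp]
  lift_comul h := by
    have h1 : TensorProduct.lift (form a c (η[A] ≫ σ)) = c ∘ₗ Linear.leftComp k A (η[A] ≫ σ) ∘ₗ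
        a.actMul := TensorProduct.ext' fun _ _ => rfl
    rw [h1]
    simp only [LinearMap.comp_apply, Linear.leftComp_apply, ← mul_comp_act, Category.assoc]
    rw [reassoc_of% hσ, one_comp_act a hc ha, map_smul, hc1, smul_eq_mul, mul_one]

end Bialgebra

/-! ### Adjunction of the form through the antipode. -/

section HopfAlgebra

open HopfAlgebra

variable [HopfAlgebra k H] (a : BialgebraAction k H A)

/-- `∑ μ ∘ (u₍₀₎ ⊗ u₍₁₎) ∘ (1 ⊗ S(g)) = ∑ μ ∘ (u₍₀₎ ⊗ u₍₁₎ S(g))`. -/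
lemma whiskerLeft_act_antipode_comp_actMul (g : H) (z : H ⊗[k] H) :
    (A ◁ a.act (antipode k g)) ≫ a.actMul z =
      a.actMul ((LinearMap.mul' k H ∘ₗ (antipode k).lTensor H).lTensor H
        (_root_.TensorProduct.assoc k H H H (z ⊗ₜ g))) := by
  induction z with
  | zero => simp
  | add s t hs ht => simp only [map_add, TensorProduct.add_tmul, Preadditive.comp_add, hs, ht]
  | tmul u v =>
    rw [actMul_tmul, ← id_tensorHom, tensorHom_comp_tensorHom_assoc, Category.id_comp, ← act_mul]
    rfl

lemma lTensor_mul_antipode_assoc_comul (u : H) :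
    (LinearMap.mul' k H ∘ₗ (antipode k).lTensor H).lTensor H
        (_root_.TensorProduct.assoc k H H H ((comul (R := k)).rTensor H (comul u))) = u ⊗ₜ 1 := by
  rw [coassoc_apply, ← LinearMap.comp_apply, ← LinearMap.lTensor_comp, LinearMap.comp_assoc,
    mul_antipode_lTensor_comul, LinearMap.lTensor_comp, LinearMap.comp_apply, lTensor_counit_comul]
  simp

variable {c : (𝟙_ C ⟶ A) →ₗ[k] k} (hc : ∀ f, f = c f • η[A]) (hc1 : c η[A] = 1)

-- Write `uh ⊗ x = ∑ u₍₀₎h ⊗ u₍₁₎S(u₍₂₎)x`. Then `u₍₀₎ ⊗ u₍₁₎` passes through `μ` as a single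
-- action, which is the counit on the unit of `A`.
include hc hc1 in
lemma form_mul_left (ha : a.IsFaithful) (e : 𝟙_ C ⟶ A ⊗ A) (u h x : H) :
    form a c e (u * h) x = form a c e h (antipode k u * x) := by
  have key : ∀ t : H ⊗[k] H, c (e ≫ (a.act h ⊗ₘ a.act x) ≫
      a.actMul ((LinearMap.mul' k H ∘ₗ (antipode k).lTensor H).lTensor H
        (_root_.TensorProduct.assoc k H H H ((comul (R := k)).rTensor H t)))) =
      form a c e h (antipode k (_root_.TensorProduct.lid k H
        ((counit (R := k)).rTensor H t)) * x) := by
    intro t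
    induction t with
    | zero => simp
    | add s t hs ht => simp only [map_add, Preadditive.comp_add, hs, ht, add_mul]
    | tmul f g =>
      rw [LinearMap.rTensor_tmul, ← whiskerLeft_act_antipode_comp_actMul, ← mul_comp_act,
        ← id_tensorHom, tensorHom_comp_tensorHom_assoc, Category.comp_id, ← act_mul]
      have h1 := congrArg (fun r => c (r ≫ a.act f)) (comp_act_mul a hc e h (antipode k g * x))
      simp only [Category.assoc, Linear.smul_comp, one_comp_act a hc ha, map_smul, hc1] at h1
      rw [h1]
      simp [mul_comm]
  have h1 := key (comul u)
  rw [lTensor_mul_antipode_assoc_comul, rTensor_counit_comul, _root_.TensorProduct.lid_tmul, one_smul,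
    actMul_tmul, tensorHom_comp_tensorHom_assoc, ← act_mul, ← act_mul, one_mul] at h1
  exact h1

end HopfAlgebra

/-! ### Cocommutativity and spanning by group-likes. -/

section Braided

variable [BraidedCategory C] [Bialgebra k H] (a : BialgebraAction k H A)

lemma braiding_comp_actMul (hA : (β_ A A).hom ≫ μ[A] = μ[A]) (t : H ⊗[k] H) :
    (β_ A A).hom ≫ a.actMul (_root_.TensorProduct.comm k H H t) = a.actMul t := by
  induction t with
  | zero => simp
  | add s t hs ht => simp only [map_add, Preadditive.comp_add, hs, ht]
  | tmul f g =>
    rw [_root_.TensorProduct.comm_tmul, actMul_tmul, ← BraidedCategory.braiding_naturality_assoc, hA,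
      actMul_tmul]

lemma actMul_comm_comul (hA : (β_ A A).hom ≫ μ[A] = μ[A]) (h : H) :
    a.actMul (_root_.TensorProduct.comm k H H (comul h)) = a.actMul (comul h) := by
  rw [← cancel_epi (β_ A A).hom, braiding_comp_actMul a hA, ← mul_comp_act, reassoc_of% hA]

end Braided

-- The unit is nonzero, since otherwise `𝟙 A = 0` and the space of morphisms from `𝟙_ C` to `A`
-- would vanish; hence it spans that line.
omit [MonoidalLinear k C] in
lemma exists_functional_of_isConnected (hA : IsConnectedAlgObj k A) :
    ∃ c : (𝟙_ C ⟶ A) →ₗ[k] k, c η[A] = 1 ∧ ∀ f, f = c f • η[A] := by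
  have hη : η[A] ≠ 0 := by
    intro h0
    have hid : 𝟙 A = 0 := by
      have h1 := MonObj.one_mul A
      rw [h0, MonoidalPreadditive.zero_whiskerRight, Limits.zero_comp] at h1
      rw [← cancel_epi (λ_ A).hom, ← h1]
      simp
    have : Subsingleton (𝟙_ C ⟶ A) := ⟨fun f g => by
      rw [← Category.comp_id f, ← Category.comp_id g, hid, Limits.comp_zero, Limits.comp_zero]⟩
    have h2 : Module.finrank k (𝟙_ C ⟶ A) = 1 := hA
    rw [Module.finrank_zero_of_subsingleton] at h2
    exact zero_ne_one h2
  obtain ⟨c, hc⟩ := Module.Projective.exists_dual_eq_one k hη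
  refine ⟨c, hc, fun f => ?_⟩
  obtain ⟨r, rfl⟩ := exists_smul_eq_of_finrank_eq_one hA hη f
  rw [map_smul, hc, smul_eq_mul, mul_one]

/-- A Hopf algebra acting faithfully on an étale algebra is spanned by its group-like elements. -/
theorem span_isGroupLikeElem_eq_top_of_isEtale [IsAlgClosed k] [BraidedCategory C]
    [HopfAlgebra k H] (a : BialgebraAction k H A) (ha : a.IsFaithful) (hA : IsEtaleAlgObj k A) :
    Submodule.span k {g : H | IsGroupLikeElem k g} = ⊤ := by
  obtain ⟨c, hc1, hc⟩ := exists_functional_of_isConnected hA.connected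
  obtain ⟨σ, hσ, hl, hr⟩ := hA.separable
  have hB := isCoseparableForm a hc hc1 ha hσ hl hr
  have hinj := hB.injective fun u h x => form_mul_left a hc hc1 ha _ u h x
  refine span_isGroupLikeElem_eq_top (fun h => ?_) hB
  -- Cocommutativity: contracting a tensor with `B(-, x)` depends only on its image under `actMul`,
  -- where `Δ h` and its flip agree.
  rw [← sub_eq_zero]
  refine eq_zero_of_lTensor_flip hinj _ fun x => (_root_.TensorProduct.rid k H).injective (ha ?_)
  change a.act _ = a.act _
  rw [← whiskerLeft_comp_actMul a hc, map_sub, actMul_comm_comul a hA.comm, sub_self]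
  simp

/-! ### Group-likes as automorphisms, and the group algebra. -/

section Aut

variable [HopfAlgebra k H] (a : BialgebraAction k H A)
  (hη : ∀ h, η[A] ≫ a.act h = counit (R := k) h • η[A])

include hη in
lemma isMonHom_act {g : H} (hg : IsGroupLikeElem k g) : IsMonHom (a.act g) where
  one_hom := by rw [hη, hg.counit_eq_one, one_smul]
  mul_hom := by rw [mul_comp_act, hg.comul_eq_tmul_self, actMul_tmul]

/-- The group-like elements act by algebra automorphisms. -/
noncomputable def groupLikeToAut : GroupLike k H →* AutAlg A where
  toFun g :=
    { hom := Mon.Hom.mk' (M := Mon.mk A) (N := Mon.mk A) (a.act g) (isMonHom_act a hη g.2).one_hom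
        (isMonHom_act a hη g.2).mul_hom
      inv := Mon.Hom.mk' (M := Mon.mk A) (N := Mon.mk A) (a.act ↑(g⁻¹))
        (isMonHom_act a hη (g⁻¹).2).one_hom (isMonHom_act a hη (g⁻¹).2).mul_hom
      hom_inv_id := by
        ext
        change a.act _ ≫ a.act _ = 𝟙 A
        rw [← act_mul, ← GroupLike.val_mul, inv_mul_cancel, GroupLike.val_one, act_one]
      inv_hom_id := by
        ext
        change a.act _ ≫ a.act _ = 𝟙 A
        rw [← act_mul, ← GroupLike.val_mul, mul_inv_cancel, GroupLike.val_one, act_one] }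
  map_one' := by
    ext
    exact a.act_one
  map_mul' g h := by
    ext
    exact a.act_mul g h

lemma groupLikeToAut_injective (ha : a.IsFaithful) :
    Function.Injective (groupLikeToAut a hη) := by
  intro g h hgh
  exact GroupLike.val_injective (ha (congrArg (fun φ : AutAlg A => φ.hom.hom) hgh))

end Aut

end BialgebraAction

/-- A bialgebra over a field spanned by its group-like elements is the monoid algebra of the monoid
of group-like elements. -/
lemma liftGroupLikeBialgHom_bijective {k H : Type*} [Field k] [Ring H] [Bialgebra k H]
    (hH : Submodule.span k {g : H | IsGroupLikeElem k g} = ⊤) :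
    Function.Bijective (MonoidAlgebra.liftGroupLikeBialgHom (R := k) (A := H)) := by
  have key : ∀ x, MonoidAlgebra.liftGroupLikeBialgHom (R := k) (A := H) x =
      Finsupp.linearCombination k (GroupLike.val (R := k) (A := H)) x.coeff := by
    intro x
    rw [Finsupp.linearCombination_apply]
    exact MonoidAlgebra.lift_apply _ _
  constructor
  · intro x y hxy
    rw [key, key] at hxy
    exact MonoidAlgebra.coeff_injective (linearIndep_groupLikeVal hxy)
  · intro h
    have hrange : Set.range (GroupLike.val (R := k) (A := H)) = {g : H | IsGroupLikeElem k g} :=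
      Set.ext fun g => ⟨by rintro ⟨g, rfl⟩; exact g.2, fun hg => ⟨⟨g, hg⟩, rfl⟩⟩
    have hh : h ∈ Submodule.span k (Set.range (GroupLike.val (R := k) (A := H))) := by
      rw [hrange, hH]
      trivial
    obtain ⟨f, rfl⟩ := Finsupp.mem_span_range_iff_exists_finsupp.1 hh
    exact ⟨MonoidAlgebra.ofCoeff f, key _⟩

theorem mainTheorem1 (k : Type w) [Field k] [IsAlgClosed k] [CharZero k]
    {C : Type u} [Category.{v} C] [Abelian C] [Linear k C] [MonoidalCategory C]
    [MonoidalPreadditive C] [MonoidalLinear k C] [BraidedCategory C] [Simple (𝟙_ C)]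
    (A : C) [MonObj A] (hA : IsEtaleAlgObj k A)
    (H : Type x) [Ring H] [HopfAlgebra k H]
    (a : BialgebraAction k H A) (ha : a.IsFaithful) :
    ∃ (G : Subgroup (AutAlg A)) (φ : MonoidAlgebra k G ≃ₐc[k] H),
      ∀ g : G, End.asHom (a.toEnd (φ (MonoidAlgebra.of k G g))) = (g : AutAlg A).hom.hom := by
  obtain ⟨c, -, hc⟩ := BialgebraAction.exists_functional_of_isConnected hA.connected
  let θ := a.groupLikeToAut (a.one_comp_act hc ha)
  let e : GroupLike k H ≃* θ.range := θ.ofInjective (a.groupLikeToAut_injective _ ha)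
  let ψ : MonoidAlgebra k (GroupLike k H) ≃ₐc[k] H := BialgEquiv.ofBijective _
    (liftGroupLikeBialgHom_bijective (a.span_isGroupLikeElem_eq_top_of_isEtale ha hA))
  -- `G` is the image of the group-likes in the automorphism group, so `k[G]` is the algebra of the
  -- group-likes, transported along `e`.
  refine ⟨θ.range, (MonoidAlgebra.domCongrBialgEquiv k k e.symm).trans ψ, fun g => ?_⟩
  obtain ⟨g, rfl⟩ := e.surjective g
  have h1 : ((MonoidAlgebra.domCongrBialgEquiv k k e.symm).trans ψ)
      (MonoidAlgebra.of k θ.range (e g)) = g := by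
    change MonoidAlgebra.liftGroupLikeBialgHom (R := k) (A := H)
      (MonoidAlgebra.domCongr k k e.symm (MonoidAlgebra.single (e g) 1)) = g
    simp
  rw [h1]
  rfl
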